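/- **The model.** Let $\mathcal V$ be a finite set of classes and $\mathcal E$ a finite set of subsets (hyperedges) of $\mathcal V$. Let $\mu$ be a probability measure on $\mathcal V$ with support exactly $\mathcal V$. The queue detail is the word of the classes of the items in line, in order of arrival; its state space is $\mathbb W=\{w\in\mathcal V^*:\ \prod_{i\in S}|w|_i=0\ \text{for all } S\in\mathcal E\}$, where $|w|_i$ is the number of letters $i$ in $w$. At each time $n\ge1$ an item of class $V_n$ arrives, where $V_1,V_2,\dots$ are i.i.d. of law $\mu$. If the queue detail is $w$ and the arriving item has class $v$, then: if no hyperedge $S\ni v$ is such that $|w|_i>0$ for all $i\in S\setminus\{v\}$, the item joins the end of the line; otherwise, under *Match the Longest* (ML), one of these hyperedges $S$ that maximizes $\sum_{i\in S}|w|_i$ is chosen (uniformly at random among the maximizers, independently of everything else), and the arriving item leaves at once together with the oldest item of each class of $S\setminus\{v\}$. The model is *stable* if the Markov chain of queue details on $\mathbb W$ is positive recurrent, i.e. from every state the first return time to that state is almost surely finite with finite mean. **Theorem.** Let $\mathcal H$ be the set of all 3-element subsets of a finite set $\mathcal V$ with $q=|\mathcal V|\ge5$, let $\mathcal J\subset\mathcal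 H$ be a family of pairwise disjoint hyperedges, and let $\mathcal H'=\mathcal H\setminus\mathcal J$, $\mathbb H'=(\mathcal V,\mathcal H')$. Let $J=\bigcup_{H\in\mathcal J}H$ and $\bar J=\mathcal V\setminus J$. Let $\mu$ be a probability measure on $\mathcal V$ with support exactly $\mathcal V$ such that 1. ($\mu\in\mathscr N_2(\mathbb H')$) $\mu(T)>\frac1{r(\mathbb H')}$ for each $T\subset\mathcal V$ that meets all hyperedges of $\mathcal H'$, where $r(\mathbb H')$ is the largest size of a hyperedge (here $3$); 2. ($\mu\in\mathscr N_3^-(\mathbb H')$) $\mu(i)<\frac1{a(\mathbb H')}$ for all $i\in\mathcal V$, where $a(\mathbb H')$ is the smallest size of a hyperedge (here $3$); 3. $\lambda_i(\mu)<0$ for all $i\in\bar J$ and $\nu_i(\mu)<0$ for all $i\in J$. Then the model $(\mathbb H',\textsc{ml},\mu)$ is stable. Here, writing $\mu_a=\mu(a)$ and $e_r(A)=\sum_{B\subset A,\,|B|=r}\ \prod_{b\in B}\mu_b$ for $A\subset \mathcal V$, and with $s_i=\mathcal V\setminus\{i\}$, $$\begin{aligned}\lambda_i(\mu)=\;&8\mu_i^4+24\mu_i^3\sum_{j\in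 s_i}\mu_j+24\mu_i^2\sum_{j\in s_i}\mu_j^2+8\mu_i\sum_{j\in s_i}\mu_j^3+24\mu_i^2\,e_2(s_i)-44\sum_{j\in s_i}\mu_j^2\,e_2(s_i\setminus\{j\})\\&-24\sum_{\{j,k\}\subset s_i,\,j\ne k}\mu_j^2\mu_k^2-8\sum_{j,k\in s_i,\,j\neq k}\mu_j\mu_k^3-96\,e_4(s_i),\end{aligned}$$ and, for $i\in J$, with $H$ the unique element of $\mathcal J$ containing $i$, $D=H\setminus\{i\}$ and $B=\mathcal V\setminus H$, $$\begin{aligned}\nu_i(\mu)=\;&8\mu_i^4+24\mu_i^3\sum_{\ell\in s_i}\mu_\ell+24\mu_i^2\sum_{\ell\in s_i}\mu_\ell^2+8\mu_i\sum_{\ell\in s_i}\mu_\ell^3-8\sum_{j\in D,\,\ell\in B}\mu_j\mu_\ell^3-24\sum_{j,k\in D,\,j\ne k}\ \sum_{\ell\in B}\mu_j\mu_k^2\mu_\ell\\ &-48\,e_2(D)\sum_{\ell\in B}\mu_\ell^2-44\sum_{j\in D}\ \sum_{\ell,m\in B,\,\ell\ne m}\mu_j\mu_\ell^2\mu_m+48\mu_i^2\,e_2(D)-88\,e_2(D)\,e_2(B)-96\sum_{j\in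 D}\mu_j\,e_3(B)\\ &+24\mu_i^2\sum_{j\in D,\,\ell\in B}\mu_j\mu_\ell+24\mu_i^2\,e_2(B)-24\sum_{j\in D,\,\ell\in B}\mu_j^2\mu_\ell^2-44\sum_{j\in D}\mu_j^2\,e_2(B)-8\sum_{j\in D,\,\ell\in B}\mu_j^3\mu_\ell\\ &+24\mu_i\sum_{j,k\in D,\,j\neq k}\mu_j\mu_k^2-8\sum_{\ell,m\in B,\,\ell\ne m}\mu_\ell^3\mu_m-24\sum_{\{\ell,m\}\subset B,\,\ell\ne m}\mu_\ell^2\mu_m^2-44\sum_{\ell\in B}\mu_\ell^2\,e_2(B\setminus\{\ell\})-96\,e_4(B).\end{aligned}$$ Sums over $j\ne k$ (or $\ell\neq m$) run over ordered pairs, sums over $\{j,k\}$ (or $\{\ell,m\}$) over unordered pairs, of distinct elements. -/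

import Mathlib

open scoped ENNReal BigOperators

noncomputable section

/-! ### Positive recurrence of a discrete-time Markov chain on a discrete state space -/

namespace MarkovChain

variable {α : Type*}

/-- `firstPassage P y n x` is the probability that the chain with transition probabilities `P`,
started at `x`, visits `y` for the first time (among the times `1, 2, …`) at time `n`. -/
def firstPassage [DecidableEq α] (P : α → PMF α) (y : α) : ℕ → α → ℝ≥0∞
  | 0, _ => 0
  | 1, x => P x y
  | n + 2, x => ∑' z, if z = y then 0 else P x z * firstPassage P y (n + 1) z

/-- The state `x` is positive recurrent: the first return time to `x` of the chain started
at `x` is almost surely finite and has a finite mean. -/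
def IsPosRecState [DecidableEq α] (P : α → PMF α) (x : α) : Prop :=
  ∑' n, firstPassage P x n x = 1 ∧ ∑' n : ℕ, (n : ℝ≥0∞) * firstPassage P x n x < ∞

/-- The chain is positive recurrent on the state space `S`: all states are. -/
def IsPosRec [DecidableEq α] (P : α → PMF α) (S : Set α) : Prop :=
  ∀ x ∈ S, IsPosRecState P x

end MarkovChain

/-! ### Hypergraphs

A hypergraph on the finite set of nodes `V` is given by its finite set of hyperedges. -/

namespace MatchingModel

variable {V : Type*}

/-- The hyperedges of the complete `r`-uniform hypergraph on `V`. -/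
def completeUniform (V : Type*) [Fintype V] (r : ℕ) : Finset (Finset V) :=
  Finset.univ.powersetCard r

/-- The largest size of a hyperedge. -/
def rank (E : Finset (Finset V)) : ℕ := E.sup Finset.card

/-- The smallest size of a hyperedge. -/
def antiRank (E : Finset (Finset V)) : ℕ := sInf {n | ∃ S ∈ E, S.card = n}

/-- `T` meets all hyperedges. -/
def IsTransversal (E : Finset (Finset V)) (T : Finset V) : Prop :=
  ∀ S ∈ E, ∃ i, i ∈ T ∧ i ∈ S

/-- The real number `μ(i)`. -/
def mass (μ : PMF V) (i : V) : ℝ := (μ i).toReal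

/-- The probability measures on `V` whose support is exactly `V`. -/
def fullSupport (V : Type*) : Set (PMF V) := {μ | μ.support = Set.univ}

/-- `N₂`: fully supported measures giving each transversal a mass larger than `1 / rank`. -/
def N2 (E : Finset (Finset V)) : Set (PMF V) :=
  {μ | μ ∈ fullSupport V ∧
    ∀ T : Finset V, IsTransversal E T → 1 / (rank E : ℝ) < ∑ i ∈ T, mass μ i}

/-- `N₃⁻`: fully supported measures giving each node a mass less than `1 / antiRank`. -/
def N3minus (E : Finset (Finset V)) : Set (PMF V) :=
  {μ | μ ∈ fullSupport V ∧ ∀ i, mass μ i < 1 / (antiRank E : ℝ)}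

/-! ### The matching model under Match the Longest

A queue detail is the word of the classes of the items in line, in their order of arrival. -/

variable [DecidableEq V]

/-- The admissible queue details: no hyperedge has all of its classes present. -/
def admissible (E : Finset (Finset V)) : Set (List V) :=
  {w | ∀ S ∈ E, ∏ i ∈ S, w.count i = 0}

/-- The matches available to an arriving item of class `v`: the hyperedges that contain `v` and
whose other classes are all present in the queue detail `w`. -/
def available (E : Finset (Finset V)) (w : List V) (v : V) : Finset (Finset V) :=
  E.filter fun S => v ∈ S ∧ ∀ i ∈ S.erase v, 0 < w.count i

/-- The total queue length `x(S)` of the classes in `S`. -/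
def queueLength (w : List V) (S : Finset V) : ℕ := ∑ i ∈ S, w.count i

/-- The available matches of largest total queue length. -/
def longest (E : Finset (Finset V)) (w : List V) (v : V) : Finset (Finset V) :=
  (available E w v).filter fun S => ∀ S' ∈ available E w v, queueLength w S' ≤ queueLength w S

theorem longest_nonempty {E : Finset (Finset V)} {w : List V} {v : V}
    (h : (available E w v).Nonempty) : (longest E w v).Nonempty := by
  obtain ⟨S, hS, hmax⟩ := Finset.exists_max_image (available E w v) (queueLength w) h
  exact ⟨S, Finset.mem_filter.2 ⟨hS, hmax⟩⟩

/-- The queue detail after an arriving `v`-item is matched within the hyperedge `S`: the oldest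
item of each class of `S` other than `v` leaves. -/
def remove (w : List V) (v : V) (S : Finset V) : List V := w.diff (S.erase v).toList

/-- The (random) queue detail after the arrival of a `v`-item: if no match is available, the item
joins the line; otherwise it is matched within an available hyperedge of largest total queue
length, ties being broken uniformly at random. -/
def arrivalML (E : Finset (Finset V)) (w : List V) (v : V) : PMF (List V) :=
  if h : (available E w v).Nonempty then
    (PMF.uniformOfFinset (longest E w v) (longest_nonempty h)).map (remove w v)
  else PMF.pure (w ++ [v])

/-- The transition probabilities of the chain of queue details: the class of the arriving item has
law `μ`, independently of the past. -/
def transitionML (E : Finset (Finset V)) (μ : PMF V) (w : List V) : PMF (List V) :=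
  μ.bind (arrivalML E w)

/-- The model with hyperedges `E`, policy Match the Longest and arrival law `μ` is stable: the
chain of queue details is positive recurrent. -/
def IsStableML (E : Finset (Finset V)) (μ : PMF V) : Prop :=
  MarkovChain.IsPosRec (transitionML E μ) (admissible E)

/-! ### The drift coefficients -/

/-- The sum of `m(a₁) ⋯ m(aᵣ)` over all sets `{a₁, …, aᵣ}` of `r` distinct elements of `s`. -/
def esum (m : V → ℝ) (s : Finset V) (r : ℕ) : ℝ := ∑ A ∈ s.powersetCard r, ∏ a ∈ A, m a

variable [Fintype V]

/-- The coefficient `λᵢ`. -/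
def driftLambda (m : V → ℝ) (i : V) : ℝ :=
  let s : Finset V := Finset.univ.erase i
  8 * m i ^ 4 + 24 * m i ^ 3 * ∑ j ∈ s, m j + 24 * m i ^ 2 * ∑ j ∈ s, m j ^ 2
    + 8 * m i * ∑ j ∈ s, m j ^ 3
    + 24 * m i ^ 2 * esum m s 2
    - 44 * ∑ j ∈ s, m j ^ 2 * esum m (s.erase j) 2
    - 24 * esum (fun a => m a ^ 2) s 2
    - 8 * ∑ j ∈ s, ∑ k ∈ s.erase j, m j * m k ^ 3
    - 96 * esum m s 4

/-- The coefficient `νᵢ`, where `H` is the deleted hyperedge that contains `i`. Below, `D` is the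
pair of the other two nodes of `H`, and `B` is the complement of `H`. -/
def driftNu (m : V → ℝ) (H : Finset V) (i : V) : ℝ :=
  let s : Finset V := Finset.univ.erase i
  let D : Finset V := H.erase i
  let B : Finset V := Hᶜ
  8 * m i ^ 4 + 24 * m i ^ 3 * ∑ l ∈ s, m l + 24 * m i ^ 2 * ∑ l ∈ s, m l ^ 2
    + 8 * m i * ∑ l ∈ s, m l ^ 3
    - 8 * ∑ j ∈ D, ∑ l ∈ B, m j * m l ^ 3
    - (4 + 20) * ∑ j ∈ D, ∑ k ∈ D.erase j, ∑ l ∈ B, m j * m k ^ 2 * m l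
    - 48 * (∏ j ∈ D, m j) * ∑ l ∈ B, m l ^ 2
    - (4 + 40) * ∑ j ∈ D, ∑ l ∈ B, ∑ n ∈ B.erase l, m j * m l ^ 2 * m n
    + 48 * m i ^ 2 * ∏ j ∈ D, m j
    - (8 + 80) * (∏ j ∈ D, m j) * esum m B 2
    - 96 * ∑ j ∈ D, m j * esum m B 3
    + 24 * m i ^ 2 * ∑ j ∈ D, ∑ l ∈ B, m j * m l
    + 24 * m i ^ 2 * esum m B 2
    - 24 * ∑ j ∈ D, ∑ l ∈ B, m j ^ 2 * m l ^ 2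
    - (4 + 40) * ∑ j ∈ D, m j ^ 2 * esum m B 2
    - 8 * ∑ j ∈ D, ∑ l ∈ B, m j ^ 3 * m l
    + 24 * m i * ∑ j ∈ D, ∑ k ∈ D.erase j, m j * m k ^ 2
    - 8 * ∑ l ∈ B, ∑ n ∈ B.erase l, m l ^ 3 * m n
    - 24 * esum (fun a => m a ^ 2) B 2
    - (4 + 40) * ∑ l ∈ B, m l ^ 2 * esum m (B.erase l) 2
    - 96 * esum m B 4

end MatchingModel

end

/-! ### Foster's criterion via the chain killed at its target state. -/

namespace MarkovChain

variable {α : Type*} [DecidableEq α]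

/-! The proof applies Foster's criterion (`MarkovChain.isPosRecState_of_drift`) to the quadratic
`energy` `3 ∑ xᵢ² - (1 - ε) n²`, with `n = ∑ xᵢ`. Two disjoint triples cannot share a pair, so an
admissible line holds at most three classes, and three only if they form a deleted hyperedge. By
Cauchy-Schwarz the energy is then nonnegative.

The drift is affine in the queue lengths (`exists_isDriftBound`). The critical lines lie in a
deleted hyperedge `H`, with at least two classes present. Let `m` be the mass of `H`, `c` its
shortest queue, and let each class have mass at most `(1 - θ) / 3`. Arrivals in `H` join; any other
arrival makes ML remove two classes and spare a shortest one. The drift is at most `6 + (-2θ - 4ε +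
6εm) n + 6θc`, where `3c ≤ n`. When the three queues are equal, only `ε (6m - 4) n` is left of the
linear part; it is negative because `m < 2 / 3`. With `ε = θ / 2` and `m ≤ (2 - θ) / 3` the drift is
at most `6 - θ² n`.

So it suffices that classes have mass below `1 / 3` (`N3minus`) and deleted hyperedges below `2 / 3`
(`N2`, applied to their complements). All admissible words communicate through the empty one, which
gives the reachability that Foster's criterion needs. -/

/-- The transition operator of the chain killed when it enters `y`. -/
noncomputable def taboo (P : α → PMF α) (y : α) (g : α → ℝ≥0∞) (x : α) : ℝ≥0∞ :=
  ∑' z, if z = y then 0 else P x z * g z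

theorem taboo_mono (P : α → PMF α) (y : α) : Monotone (taboo P y) := by
  intro g h hgh x
  refine ENNReal.tsum_le_tsum fun z => ?_
  split_ifs
  · exact le_rfl
  · gcongr
    exact hgh z

theorem taboo_add (P : α → PMF α) (y : α) (g h : α → ℝ≥0∞) :
    taboo P y (g + h) = taboo P y g + taboo P y h := by
  ext x
  simp only [taboo, Pi.add_apply]
  rw [← ENNReal.tsum_add]
  refine tsum_congr fun z => ?_
  split_ifs <;> simp [mul_add]

theorem taboo_smul (P : α → PMF α) (y : α) (c : ℝ≥0∞) (g : α → ℝ≥0∞) :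
    taboo P y (c • g) = c • taboo P y g := by
  ext x
  simp only [taboo, Pi.smul_apply, smul_eq_mul]
  rw [← ENNReal.tsum_mul_left]
  refine tsum_congr fun z => ?_
  split_ifs
  · simp
  · ring

theorem taboo_le (P : α → PMF α) (y : α) (g : α → ℝ≥0∞) (x : α) :
    taboo P y g x ≤ ∑' z, P x z * g z := by
  refine ENNReal.tsum_le_tsum fun z => ?_
  split_ifs <;> simp

theorem taboo_iterate_add (P : α → PMF α) (y : α) (n : ℕ) (g h : α → ℝ≥0∞) :
    (taboo P y)^[n] (g + h) = (taboo P y)^[n] g + (taboo P y)^[n] h := by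
  induction n with
  | zero => rfl
  | succ n ih => simp only [Function.iterate_succ_apply', ih, taboo_add]

theorem taboo_iterate_smul (P : α → PMF α) (y : α) (n : ℕ) (c : ℝ≥0∞) (g : α → ℝ≥0∞) :
    (taboo P y)^[n] (c • g) = c • (taboo P y)^[n] g := by
  induction n with
  | zero => rfl
  | succ n ih => simp only [Function.iterate_succ_apply', ih, taboo_smul]

/-- The probability that the chain started at `x` does not visit `y` at the times `1, …, n`. -/
noncomputable def survival (P : α → PMF α) (y : α) (n : ℕ) : α → ℝ≥0∞ :=
  (taboo P y)^[n] 1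

theorem survival_succ (P : α → PMF α) (y : α) (n : ℕ) :
    survival P y (n + 1) = taboo P y (survival P y n) :=
  Function.iterate_succ_apply' _ _ _

theorem firstPassage_one_add (P : α → PMF α) (y x : α) :
    firstPassage P y 1 x + taboo P y 1 x = 1 := by
  have h : ∀ z, (if z = y then P x z else 0) + (if z = y then 0 else P x z * 1) = P x z := by
    intro z
    split_ifs <;> simp
  have h1 : firstPassage P y 1 x = ∑' z, if z = y then P x z else 0 := by
    rw [tsum_eq_single y (fun z hz => if_neg hz), if_pos rfl, firstPassage]
  rw [h1, taboo, ← ENNReal.tsum_add, ← (P x).tsum_coe]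
  exact tsum_congr h

/-- From time 1 on, first-passage and survival probabilities both advance by `taboo`, so the
one-step case propagates. -/
theorem firstPassage_succ_add_survival (P : α → PMF α) (y : α) (n : ℕ) :
    firstPassage P y (n + 1) + survival P y (n + 1) = survival P y n := by
  induction n with
  | zero =>
    ext x
    exact firstPassage_one_add P y x
  | succ n ih =>
    have h : firstPassage P y (n + 2) = taboo P y (firstPassage P y (n + 1)) := by
      ext x
      rw [firstPassage, taboo]
    rw [h, survival_succ P y (n + 1), ← taboo_add, ih, survival_succ]

theorem survival_antitone (P : α → PMF α) (y : α) : Antitone (survival P y) := by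
  refine antitone_nat_of_succ_le fun n => ?_
  rw [← firstPassage_succ_add_survival P y n]
  exact le_add_self

theorem survival_le_one (P : α → PMF α) (y : α) (n : ℕ) (x : α) : survival P y n x ≤ 1 :=
  survival_antitone P y (Nat.zero_le n) x

theorem sum_firstPassage_add_survival (P : α → PMF α) (y x : α) (n : ℕ) :
    ∑ k ∈ Finset.range (n + 1), firstPassage P y k x + survival P y n x = 1 := by
  induction n with
  | zero => simp [firstPassage, survival]
  | succ n ih =>
    rw [Finset.sum_range_succ, add_assoc, ← Pi.add_apply, firstPassage_succ_add_survival, ih]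

/-- Abel summation: the truncated mean of the return time is a sum of tail probabilities. -/
theorem sum_mul_firstPassage_add (P : α → PMF α) (y x : α) (n : ℕ) :
    ∑ k ∈ Finset.range (n + 1), (k : ℝ≥0∞) * firstPassage P y k x + n * survival P y n x
      = ∑ k ∈ Finset.range n, survival P y k x := by
  induction n with
  | zero => simp
  | succ n ih =>
    have h : firstPassage P y (n + 1) x + survival P y (n + 1) x = survival P y n x :=
      congrFun (firstPassage_succ_add_survival P y n) x
    rw [Finset.sum_range_succ _ (n + 1), Finset.sum_range_succ (fun k => survival P y k x), ← ih, ← h]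
    push_cast
    ring

theorem isPosRecState_of_tsum_survival (P : α → PMF α) (x : α)
    (h : ∑' n, survival P x n x ≠ ∞) : IsPosRecState P x := by
  constructor
  · have h1 : Filter.Tendsto (fun n => ∑ k ∈ Finset.range (n + 1), firstPassage P x k x
        + survival P x n x) Filter.atTop (nhds (∑' n, firstPassage P x n x + 0)) :=
      (((ENNReal.tendsto_nat_tsum _).comp (Filter.tendsto_add_atTop_nat 1))).add
        (ENNReal.tendsto_atTop_zero_of_tsum_ne_top h)
    simp only [sum_firstPassage_add_survival, add_zero] at h1
    exact tendsto_nhds_unique h1 tendsto_const_nhds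
  · refine lt_of_le_of_lt ?_ (lt_top_iff_ne_top.2 h)
    refine ENNReal.tsum_le_of_sum_range_le fun n => ?_
    calc ∑ k ∈ Finset.range n, (k : ℝ≥0∞) * firstPassage P x k x
        ≤ ∑ k ∈ Finset.range (n + 1), (k : ℝ≥0∞) * firstPassage P x k x :=
          Finset.sum_le_sum_of_subset (Finset.range_mono n.le_succ)
      _ ≤ ∑ k ∈ Finset.range n, survival P x k x := by
          rw [← sum_mul_firstPassage_add]
          exact le_self_add
      _ ≤ ∑' k, survival P x k x := ENNReal.sum_le_tsum _

theorem survival_succ_lt_one {P : α → PMF α} {x y z : α} {n : ℕ} (hz : P x z ≠ 0)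
    (h : z = y ∨ survival P y n z < 1) : survival P y (n + 1) x < 1 := by
  rw [survival_succ, taboo, ← (P x).tsum_coe]
  refine ENNReal.tsum_lt_tsum (i := z) ?_ (fun w => ?_) ?_
  · refine ne_top_of_le_ne_top ENNReal.one_ne_top ?_
    rw [← (P x).tsum_coe]
    refine ENNReal.tsum_le_tsum fun w => ?_
    split_ifs
    · exact zero_le
    · exact mul_le_of_le_one_right' (survival_le_one P y n w)
  · split_ifs
    · exact zero_le
    · exact mul_le_of_le_one_right' (survival_le_one P y n w)
  · split_ifs with hzy
    · exact pos_iff_ne_zero.2 hz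
    · calc P x z * survival P y n z < P x z * 1 :=
            ENNReal.mul_lt_mul_right hz ((P x).apply_ne_top z) (h.resolve_left hzy)
        _ = P x z := mul_one _

theorem exists_survival_lt_one {P : α → PMF α} {x y : α}
    (h : Relation.TransGen (fun a b => P a b ≠ 0) x y) : ∃ n, survival P y n x < 1 := by
  induction h using Relation.TransGen.head_induction_on with
  | single h => exact ⟨1, survival_succ_lt_one (n := 0) h (Or.inl rfl)⟩
  | head h _ ih =>
    obtain ⟨n, hn⟩ := ih
    exact ⟨n + 1, survival_succ_lt_one h (Or.inr hn)⟩

/-- Survival decreases in time, so finitely many states can share the largest horizon and the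
smallest killing probability. -/
theorem exists_survival_add_le_one {P : α → PMF α} {y : α} {C : Set α} (hC : C.Finite)
    (h : ∀ x ∈ C, Relation.TransGen (fun a b => P a b ≠ 0) x y) :
    ∃ (m : ℕ) (η : ℝ≥0∞), η ≠ 0 ∧ ∀ x ∈ C, η + survival P y m x ≤ 1 := by
  induction C, hC using Set.Finite.induction_on with
  | empty => exact ⟨0, 1, one_ne_zero, by simp⟩
  | @insert a C _ _ ih =>
    obtain ⟨m, η, hη, hm⟩ := ih fun x hx => h x (Set.mem_insert_of_mem a hx)
    obtain ⟨n, hn⟩ := exists_survival_lt_one (h a (Set.mem_insert a C))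
    refine ⟨max m n, min η (1 - survival P y n a), ?_, ?_⟩
    · exact (lt_min (pos_iff_ne_zero.2 hη) (tsub_pos_of_lt hn)).ne'
    · rintro x (rfl | hx)
      · calc min η (1 - survival P y n x) + survival P y (max m n) x
            ≤ (1 - survival P y n x) + survival P y n x :=
              add_le_add (min_le_right _ _) (survival_antitone P y (le_max_right m n) x)
          _ = 1 := tsub_add_cancel_of_le hn.le
      · exact (add_le_add (min_le_left _ _)
          (survival_antitone P y (le_max_left m n) x)).trans (hm x hx)

/-- The killed chain spends a bounded expected time in a set from which it is killed within `m`
steps with probability at least `η`. -/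
theorem sum_taboo_iterate_indicator_le {P : α → PMF α} {y : α} {C : Set α} {m : ℕ} {η : ℝ≥0∞}
    (h : ∀ x ∈ C, η + survival P y m x ≤ 1) (n : ℕ) (x : α) :
    η * ∑ k ∈ Finset.range n, (taboo P y)^[k] (C.indicator 1) x ≤ m := by
  have h1 : η • C.indicator (1 : α → ℝ≥0∞) + survival P y m ≤ 1 := by
    intro z
    by_cases hz : z ∈ C
    · simpa [hz] using h z hz
    · simpa [hz] using survival_le_one P y m z
  have h2 : ∀ k, η * (taboo P y)^[k] (C.indicator 1) x + survival P y (m + k) x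
      ≤ survival P y k x := by
    intro k
    -- Pushing `h1` through `k` killed steps bounds the visit at time `k` by a difference of
    -- survivals at lag `m`; in the sum over `k`, at most the first `m` survivals remain.
    have h3 := (taboo_mono P y).iterate k h1 x
    rw [taboo_iterate_add, taboo_iterate_smul, survival, ← Function.iterate_add_apply,
      add_comm k m] at h3
    exact h3
  have h4 : η * ∑ k ∈ Finset.range n, (taboo P y)^[k] (C.indicator 1) x
      + ∑ k ∈ Finset.range n, survival P y (m + k) x
      ≤ m + ∑ k ∈ Finset.range n, survival P y (m + k) x := by
    calc _ ≤ ∑ k ∈ Finset.range n, survival P y k x := by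
          rw [Finset.mul_sum, ← Finset.sum_add_distrib]
          exact Finset.sum_le_sum fun k _ => h2 k
      _ ≤ ∑ k ∈ Finset.range (m + n), survival P y k x :=
          Finset.sum_le_sum_of_subset (Finset.range_mono (Nat.le_add_left n m))
      _ = ∑ k ∈ Finset.range m, survival P y k x
          + ∑ k ∈ Finset.range n, survival P y (m + k) x := Finset.sum_range_add _ _ _
      _ ≤ _ := by
          gcongr
          refine (Finset.sum_le_sum fun k _ => survival_le_one P y k x).trans ?_
          simp
  refine (ENNReal.add_le_add_iff_right ?_).1 h4
  exact ENNReal.sum_ne_top.2 fun k _ =>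
    ne_top_of_le_ne_top ENNReal.one_ne_top (survival_le_one P y _ x)

/-- Iterated drift inequality for the killed chain. -/
theorem sum_survival_le {P : α → PMF α} {y : α} {C : Set α} {f : α → ℝ≥0∞} {b : ℝ≥0∞}
    (h : taboo P y f + 1 ≤ f + b • C.indicator 1) (n : ℕ) :
    (taboo P y)^[n] f + ∑ k ∈ Finset.range n, survival P y k
      ≤ f + b • ∑ k ∈ Finset.range n, (taboo P y)^[k] (C.indicator 1) := by
  induction n with
  | zero => simp
  | succ n ih =>
    have h1 := (taboo_mono P y).iterate n h
    rw [taboo_iterate_add, taboo_iterate_add, taboo_iterate_smul,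
      ← Function.iterate_succ_apply] at h1
    calc _ = ((taboo P y)^[n + 1] f + survival P y n)
          + ∑ k ∈ Finset.range n, survival P y k := by
          rw [Finset.sum_range_succ]; abel
      _ ≤ ((taboo P y)^[n] f + b • (taboo P y)^[n] (C.indicator 1))
          + ∑ k ∈ Finset.range n, survival P y k := add_le_add_left h1 _
      _ = ((taboo P y)^[n] f + ∑ k ∈ Finset.range n, survival P y k)
          + b • (taboo P y)^[n] (C.indicator 1) := by abel
      _ ≤ (f + b • ∑ k ∈ Finset.range n, (taboo P y)^[k] (C.indicator 1))
          + b • (taboo P y)^[n] (C.indicator 1) := add_le_add_left ih _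
      _ = _ := by rw [Finset.sum_range_succ, smul_add, add_assoc]

/-- **Foster's criterion**: a state that can be reached from each state of a finite set `C`
is positive recurrent if `f` has a drift of at most `-1` outside `C`, and of at most `b - 1`
on `C`. -/
theorem isPosRecState_of_drift {P : α → PMF α} {x : α} {C : Set α} (hC : C.Finite)
    {f : α → ℝ≥0∞} {b : ℝ≥0∞} (hb : b ≠ ∞)
    (hf : ∀ w, ∑' z, P w z * f z + 1 ≤ f w + b * C.indicator 1 w)
    (hx : f x ≠ ∞) (hreach : ∀ w ∈ C, Relation.TransGen (fun a b => P a b ≠ 0) w x) :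
    IsPosRecState P x := by
  obtain ⟨m, η, hη, hm⟩ := exists_survival_add_le_one hC hreach
  refine isPosRecState_of_tsum_survival P x (ne_top_of_le_ne_top (b := f x + b * (m / η)) ?_ ?_)
  · exact ENNReal.add_ne_top.2
      ⟨hx, ENNReal.mul_ne_top hb (ENNReal.div_ne_top (ENNReal.natCast_ne_top m) hη)⟩
  · refine ENNReal.tsum_le_of_sum_range_le fun n => ?_
    have h1 : taboo P x f + 1 ≤ f + b • C.indicator 1 := fun w =>
      (add_le_add_left (taboo_le P x f w) 1).trans (hf w)
    have h2 := sum_survival_le h1 n x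
    simp only [Pi.add_apply, Finset.sum_apply, Pi.smul_apply, smul_eq_mul] at h2
    refine (le_add_self.trans h2).trans ?_
    gcongr
    -- An infinite `η` is possible when `C` is empty; then `m / η` may be `0`, and the sum itself
    -- has to vanish.
    by_cases hηt : η = ∞
    · have := sum_taboo_iterate_indicator_le hm n x
      rw [hηt] at this
      have h0 : ∑ k ∈ Finset.range n, (taboo P x)^[k] (C.indicator 1) x = 0 := by
        by_contra h0
        rw [ENNReal.top_mul h0] at this
        exact ENNReal.natCast_ne_top m (top_le_iff.1 this)
      simp [h0]
    · rw [ENNReal.le_div_iff_mul_le (Or.inl hη) (Or.inl hηt), mul_comm]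
      exact sum_taboo_iterate_indicator_le hm n x

end MarkovChain
-- Masses, counts and single arrivals for a general hypergraph.
namespace MatchingModel

variable {V : Type*}

theorem sum_mass [Fintype V] (μ : PMF V) : ∑ v, mass μ v = 1 := by
  have h := μ.tsum_coe
  rw [tsum_fintype] at h
  simp only [mass]
  rw [← ENNReal.toReal_sum fun v _ => μ.apply_ne_top v, h, ENNReal.toReal_one]

theorem mass_nonneg (μ : PMF V) (v : V) : 0 ≤ mass μ v := ENNReal.toReal_nonneg

theorem ofReal_mass (μ : PMF V) (v : V) : ENNReal.ofReal (mass μ v) = μ v :=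
  ENNReal.ofReal_toReal (μ.apply_ne_top v)

variable [DecidableEq V]

theorem mem_admissible_iff {E : Finset (Finset V)} {w : List V} :
    w ∈ admissible E ↔ ∀ S ∈ E, ¬ S ⊆ w.toFinset := by
  refine forall₂_congr fun S _ => ?_
  simp [Finset.prod_eq_zero_iff, Finset.not_subset, List.count_eq_zero]

theorem mem_available_iff {E : Finset (Finset V)} {w : List V} {v : V} {S : Finset V} :
    S ∈ available E w v ↔ S ∈ E ∧ v ∈ S ∧ S.erase v ⊆ w.toFinset := by
  simp [available, Finset.subset_iff, List.count_pos_iff]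

theorem mem_support_arrivalML {E : Finset (Finset V)} {w w' : List V} {v : V} :
    w' ∈ (arrivalML E w v).support ↔
      (available E w v = ∅ ∧ w' = w ++ [v]) ∨ ∃ S ∈ longest E w v, remove w v S = w' := by
  unfold arrivalML
  split_ifs with h
  · rw [PMF.mem_support_map_iff]
    simp [h.ne_empty]
  · have h0 : available E w v = ∅ := Finset.not_nonempty_iff_eq_empty.1 h
    simp [h0, longest]

theorem available_subset_insert {E : Finset (Finset V)} {w : List V} {v : V} {S : Finset V}
    (h : S ∈ available E w v) : S ⊆ insert v w.toFinset := by
  rw [Finset.subset_insert_iff]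
  exact (mem_available_iff.1 h).2.2

/-- A hyperedge completed by the arrival must contain `v`, since none was complete before. -/
theorem available_eq_empty_iff {E : Finset (Finset V)} {w : List V} {v : V}
    (hw : w ∈ admissible E) : available E w v = ∅ ↔ w ++ [v] ∈ admissible E := by
  rw [mem_admissible_iff, Finset.eq_empty_iff_forall_notMem]
  have hi : (w ++ [v]).toFinset = insert v w.toFinset := by
    ext
    simp
  rw [hi]
  constructor
  · intro h S hS hsub
    by_cases hv : v ∈ S
    · exact h S (mem_available_iff.2 ⟨hS, hv, Finset.subset_insert_iff.1 hsub⟩)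
    · exact mem_admissible_iff.1 hw S hS ((Finset.subset_insert_iff_of_notMem hv).1 hsub)
  · intro h S hS
    exact h S (mem_available_iff.1 hS).1 (available_subset_insert hS)

theorem mem_longest_iff {E : Finset (Finset V)} {w : List V} {v : V} {S : Finset V} :
    S ∈ longest E w v ↔ S ∈ available E w v ∧
      ∀ S' ∈ available E w v, queueLength w S' ≤ queueLength w S := Finset.mem_filter

theorem longest_subset_available (E : Finset (Finset V)) (w : List V) (v : V) :
    longest E w v ⊆ available E w v := Finset.filter_subset _ _

theorem count_remove (w : List V) (v : V) (S : Finset V) (i : V) :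
    (remove w v S).count i = w.count i - if i ∈ S.erase v then 1 else 0 := by
  rw [remove, List.count_diff, List.Nodup.count (Finset.nodup_toList _)]
  simp only [Finset.mem_toList]

theorem length_eq_sum_count [Fintype V] (w : List V) : w.length = ∑ i, w.count i := by
  rw [← List.sum_toFinset_count_eq_length]
  refine Finset.sum_subset (Finset.subset_univ _) fun i _ hi => ?_
  rw [List.mem_toFinset] at hi
  exact List.count_eq_zero_of_not_mem hi

theorem cast_length_eq_sum [Fintype V] (w : List V) :
    (w.length : ℝ) = ∑ i, (w.count i : ℝ) := by
  rw [length_eq_sum_count]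
  push_cast
  rfl

theorem cast_length_eq_sum_of_subset {w : List V} {A : Finset V}
    (h : w.toFinset ⊆ A) : (w.length : ℝ) = ∑ i ∈ A, (w.count i : ℝ) := by
  rw [← List.sum_toFinset_count_eq_length]
  push_cast
  refine Finset.sum_subset h fun i _ hi => ?_
  rw [List.mem_toFinset] at hi
  simp [List.count_eq_zero_of_not_mem hi]

/-- Each count is split into the level `c` and a nonnegative excess. Only the excess is charged at
the rate `a`; the level keeps the true mass of `A`. -/
theorem sum_mass_mul_count_le {w : List V} {μ : PMF V} {a : ℝ} (hμ : ∀ i, mass μ i ≤ a) {A : Finset V}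
    (hw : w.toFinset ⊆ A) {c : ℝ} (hc : ∀ i ∈ A, c ≤ w.count i) :
    ∑ i ∈ A, mass μ i * (w.count i : ℝ)
      ≤ a * (w.length - A.card * c) + (∑ i ∈ A, mass μ i) * c := by
  have h : ∀ i ∈ A, mass μ i * (w.count i : ℝ) ≤ a * (w.count i - c) + mass μ i * c := by
    intro i hi
    have := mul_le_mul_of_nonneg_right (hμ i) (sub_nonneg.2 (hc i hi))
    linarith
  refine (Finset.sum_le_sum h).trans (le_of_eq ?_)
  rw [Finset.sum_add_distrib, ← Finset.mul_sum, ← Finset.sum_mul, Finset.sum_sub_distrib,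
    Finset.sum_const, nsmul_eq_mul, ← cast_length_eq_sum_of_subset hw]

theorem cast_count_remove {w : List V} {v : V} {S : Finset V}
    (h : S.erase v ⊆ w.toFinset) (i : V) :
    ((remove w v S).count i : ℝ) = w.count i - if i ∈ S.erase v then 1 else 0 := by
  rw [count_remove]
  split_ifs with hi
  · have : 1 ≤ w.count i := List.count_pos_iff.2 (List.mem_toFinset.1 (h hi))
    push_cast [this]
    rfl
  · simp

theorem remove_mem_admissible {E : Finset (Finset V)} {w : List V} (hw : w ∈ admissible E)
    (v : V) (S : Finset V) : remove w v S ∈ admissible E := by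
  rw [mem_admissible_iff] at hw ⊢
  intro S' hS' hsub
  refine hw S' hS' (hsub.trans fun i hi => ?_)
  rw [List.mem_toFinset] at hi ⊢
  exact List.diff_subset _ _ hi

theorem mem_admissible_of_mem_support {E : Finset (Finset V)} {w w' : List V} {v : V}
    (hw : w ∈ admissible E) (h : w' ∈ (arrivalML E w v).support) : w' ∈ admissible E := by
  rcases mem_support_arrivalML.1 h with ⟨h0, rfl⟩ | ⟨S, _, rfl⟩
  · exact (available_eq_empty_iff hw).1 h0
  · exact remove_mem_admissible hw v S

/-! ### The quadratic energy and its one-step changes. -/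

section Energy

variable [Fintype V]

/-- The quadratic Lyapunov function `3 ∑ xᵢ² - (1 - ε) (∑ xᵢ)²` of the queue lengths. -/
noncomputable def energy (ε : ℝ) (w : List V) : ℝ :=
  3 * ∑ i, (w.count i : ℝ) ^ 2 - (1 - ε) * (w.length : ℝ) ^ 2

theorem energy_concat (ε : ℝ) (w : List V) (v : V) :
    energy ε (w ++ [v])
      = energy ε w + (6 * w.count v + 3 - (1 - ε) * (2 * w.length + 1)) := by
  have h : ∀ i, ((w ++ [v]).count i : ℝ) ^ 2
      = (w.count i : ℝ) ^ 2 + if i = v then 2 * (w.count i : ℝ) + 1 else 0 := by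
    intro i
    rw [List.count_append, List.count_singleton']
    by_cases hi : i = v
    · subst hi
      simp only [if_true]
      push_cast
      ring
    · simp [hi, Ne.symm hi]
  simp only [energy, h, Finset.sum_add_distrib, Finset.sum_ite_eq', Finset.mem_univ, if_true,
    List.length_append, List.length_singleton]
  push_cast
  ring

theorem cast_length_remove {w : List V} {v : V} {S : Finset V}
    (h : S.erase v ⊆ w.toFinset) :
    ((remove w v S).length : ℝ) = w.length - (S.erase v).card := by
  rw [cast_length_eq_sum, cast_length_eq_sum w]
  simp only [cast_count_remove h, Finset.sum_sub_distrib, Finset.sum_ite_mem,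
    Finset.univ_inter, Finset.sum_const, nsmul_eq_mul, mul_one]

theorem energy_remove (ε : ℝ) {w : List V} {v : V} {S : Finset V}
    (h : S.erase v ⊆ w.toFinset) (hc : (S.erase v).card = 2) :
    energy ε (remove w v S)
      = energy ε w + (-6 * ∑ i ∈ S.erase v, (w.count i : ℝ) + 6
        + (1 - ε) * (4 * w.length - 4)) := by
  have h1 : ∀ i, ((remove w v S).count i : ℝ) ^ 2
      = (w.count i : ℝ) ^ 2 + if i ∈ S.erase v then 1 - 2 * (w.count i : ℝ) else 0 := by
    intro i
    rw [cast_count_remove h]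
    split_ifs <;> ring
  rw [energy, energy, cast_length_remove h, hc]
  simp only [h1, Finset.sum_add_distrib, Finset.sum_ite_mem, Finset.univ_inter,
    Finset.sum_sub_distrib, ← Finset.mul_sum, Finset.sum_const, hc]
  push_cast
  ring

/-- Cauchy-Schwarz over the classes present; this is the origin of the factor 3 in `energy`. -/
theorem energy_nonneg {ε : ℝ} (hε : 0 ≤ ε) {w : List V} (h : w.toFinset.card ≤ 3) :
    0 ≤ energy ε w := by
  have h1 : (w.length : ℝ) ^ 2 ≤ 3 * ∑ i, (w.count i : ℝ) ^ 2 := by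
    calc (w.length : ℝ) ^ 2 = (∑ i ∈ w.toFinset, (w.count i : ℝ)) ^ 2 := by
          rw [cast_length_eq_sum_of_subset subset_rfl]
      _ ≤ w.toFinset.card * ∑ i ∈ w.toFinset, (w.count i : ℝ) ^ 2 := sq_sum_le_card_mul_sum_sq
      _ ≤ 3 * ∑ i, (w.count i : ℝ) ^ 2 := by
          gcongr
          · exact_mod_cast h
          · exact Finset.subset_univ _
  have h2 : 0 ≤ ε * (w.length : ℝ) ^ 2 := by positivity
  unfold energy
  linarith

/-- Tie-breaking is bounded by its worst outcome; only the arriving class is averaged. -/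
theorem tsum_transitionML_mul_le {E : Finset (Finset V)} {μ : PMF V} {w : List V}
    {F : List V → ℝ≥0∞} {B : V → ℝ≥0∞}
    (h : ∀ v, ∀ w' ∈ (arrivalML E w v).support, F w' ≤ B v) :
    ∑' z, transitionML E μ w z * F z ≤ ∑ v, μ v * B v := by
  have h1 : ∀ v, ∑' z, arrivalML E w v z * F z ≤ B v := by
    intro v
    calc ∑' z, arrivalML E w v z * F z ≤ ∑' z, arrivalML E w v z * B v := by
          refine ENNReal.tsum_le_tsum fun z => ?_
          by_cases hz : arrivalML E w v z = 0
          · simp [hz]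
          · gcongr
            exact h v z hz
      _ = B v := by rw [ENNReal.tsum_mul_right, PMF.tsum_coe, one_mul]
  calc ∑' z, transitionML E μ w z * F z
      = ∑ v, μ v * ∑' z, arrivalML E w v z * F z := by
        simp only [transitionML, PMF.bind_apply, ← ENNReal.tsum_mul_right]
        rw [ENNReal.tsum_comm, tsum_fintype]
        simp only [← ENNReal.tsum_mul_left, mul_assoc]
    _ ≤ _ := by
        gcongr with v
        exact h1 v

theorem sum_mass_mul_ite (μ : PMF V) (A : Finset V) (g : V → ℝ) (c : ℝ) :
    ∑ v, mass μ v * (if v ∈ A then g v else c)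
      = ∑ v ∈ A, mass μ v * g v + (1 - ∑ v ∈ A, mass μ v) * c := by
  have h1 : ∀ v, mass μ v * (if v ∈ A then g v else c)
      = (if v ∈ A then mass μ v * g v - mass μ v * c else 0) + mass μ v * c := by
    intro v
    split_ifs <;> ring
  simp only [h1, Finset.sum_add_distrib, Finset.sum_ite_mem, Finset.univ_inter,
    Finset.sum_sub_distrib, ← Finset.sum_mul, sum_mass]
  ring

end Energy

end MatchingModel
namespace MatchingModel

variable {V : Type*} [Fintype V] [DecidableEq V]

/-! ### Triples that avoid a disjoint family. -/

section Combinatorics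

variable {J : Finset (Finset V)}

theorem mem_completeUniform_sdiff {r : ℕ} {S : Finset V} :
    S ∈ completeUniform V r \ J ↔ S.card = r ∧ S ∉ J := by
  simp [completeUniform, Finset.mem_powersetCard]

/-- Of two candidates outside `T`, at most one gives a deleted triple, since both triples contain
`T`. -/
theorem exists_insert_mem (hq : 5 ≤ Fintype.card V)
    (hdisj : (J : Set (Finset V)).PairwiseDisjoint id) {T : Finset V} (hT : T.card = 2) :
    ∃ v, v ∉ T ∧ insert v T ∈ completeUniform V 3 \ J := by
  have hc : 1 < (Tᶜ).card := by
    rw [Finset.card_compl, hT]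
    omega
  obtain ⟨a, ha, b, hb, hab⟩ := Finset.one_lt_card.1 hc
  rw [Finset.mem_compl] at ha hb
  by_cases h : insert a T ∈ J
  · refine ⟨b, hb, mem_completeUniform_sdiff.2 ⟨by rw [Finset.card_insert_of_notMem hb, hT],
      fun h' => ?_⟩⟩
    obtain ⟨i, hi⟩ : T.Nonempty := Finset.card_pos.1 (by omega)
    have he := hdisj.elim_finset h h' i (Finset.mem_insert_of_mem hi)
      (Finset.mem_insert_of_mem hi)
    have : a ∈ insert b T := he ▸ Finset.mem_insert_self a T
    exact (Finset.mem_insert.1 this).elim hab ha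
  · exact ⟨a, ha, mem_completeUniform_sdiff.2 ⟨by rw [Finset.card_insert_of_notMem ha, hT], h⟩⟩

/-- Among four present classes every triple would be deleted, yet two such triples overlap. -/
theorem card_toFinset_le_three
    (hdisj : (J : Set (Finset V)).PairwiseDisjoint id) {w : List V}
    (hw : w ∈ admissible (completeUniform V 3 \ J)) : w.toFinset.card ≤ 3 := by
  have hmem : ∀ S ⊆ w.toFinset, S.card = 3 → S ∈ J := fun S hS hc => by
    by_contra h
    exact mem_admissible_iff.1 hw S (mem_completeUniform_sdiff.2 ⟨hc, h⟩) hS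
  by_contra! h
  obtain ⟨A, hA, hAc⟩ := Finset.exists_subset_card_eq (show 4 ≤ w.toFinset.card by omega)
  obtain ⟨a, ha⟩ : A.Nonempty := Finset.card_pos.1 (by omega)
  obtain ⟨b, hb⟩ : (A.erase a).Nonempty :=
    Finset.card_pos.1 (by rw [Finset.card_erase_of_mem ha]; omega)
  have hbA := Finset.mem_of_mem_erase hb
  have h1 : A.erase a ∈ J := hmem _ ((Finset.erase_subset _ _).trans hA)
    (by rw [Finset.card_erase_of_mem ha]; omega)
  have h2 : A.erase b ∈ J := hmem _ ((Finset.erase_subset _ _).trans hA)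
    (by rw [Finset.card_erase_of_mem hbA]; omega)
  obtain ⟨c, hc⟩ : ((A.erase a).erase b).Nonempty := Finset.card_pos.1
    (by rw [Finset.card_erase_of_mem hb, Finset.card_erase_of_mem ha]; omega)
  simp only [Finset.mem_erase] at hc
  have he := hdisj.elim_finset h1 h2 c (by simp [hc]) (by simp [hc])
  exact Finset.notMem_erase b A (he ▸ hb)

theorem card_erase_of_mem_available {w : List V} {v : V} {S : Finset V}
    (hS : S ∈ available (completeUniform V 3 \ J) w v) : (S.erase v).card = 2 := by
  obtain ⟨hSE, hv, -⟩ := mem_available_iff.1 hS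
  rw [Finset.card_erase_of_mem hv, (mem_completeUniform_sdiff.1 hSE).1]

/-- If all the classes in line belong to a deleted hyperedge `H`, an item of a class in `H`
joins the line. -/
theorem available_eq_empty_of_mem {H : Finset V} (hHJ : H ∈ J) (hH : H.card = 3) {w : List V}
    (hw : w.toFinset ⊆ H) {v : V} (hv : v ∈ H) :
    available (completeUniform V 3 \ J) w v = ∅ := by
  refine Finset.eq_empty_iff_forall_notMem.2 fun S hS => ?_
  have hsub : S ⊆ H := (available_subset_insert hS).trans (Finset.insert_subset hv hw)
  obtain ⟨hc, hSJ⟩ := mem_completeUniform_sdiff.1 (mem_available_iff.1 hS).1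
  exact hSJ (Finset.eq_of_subset_of_card_le hsub (by omega) ▸ hHJ)

theorem mem_completeUniform_sdiff_of_notMem
    (hdisj : (J : Set (Finset V)).PairwiseDisjoint id) {H T : Finset V} (hH : H ∈ J)
    (hT : T ⊆ H) (hTc : T.card = 2) {v : V} (hv : v ∉ H) :
    insert v T ∈ completeUniform V 3 \ J := by
  refine mem_completeUniform_sdiff.2
    ⟨by rw [Finset.card_insert_of_notMem fun h => hv (hT h), hTc], fun h => hv ?_⟩
  obtain ⟨i, hi⟩ : T.Nonempty := Finset.card_pos.1 (by omega)
  rw [hdisj.elim_finset hH h i (hT hi) (Finset.mem_insert_of_mem hi)]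
  exact Finset.mem_insert_self v T

/-- If all the classes in line belong to a deleted hyperedge `H`, at least two of them being
present, then the arrival of an item of a class outside of `H` removes two items of `H`, and the
class that is left untouched is a shortest one. -/
theorem longest_of_subset (hdisj : (J : Set (Finset V)).PairwiseDisjoint id) {H : Finset V}
    (hHJ : H ∈ J) (hH : H.card = 3) {w : List V} (hw : w.toFinset ⊆ H) {v : V} (hv : v ∉ H)
    {S : Finset V} (hS : S ∈ longest (completeUniform V 3 \ J) w v) :
    ∃ r ∈ H, S.erase v = H.erase r ∧ ∀ i ∈ H, w.count r ≤ w.count i := by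
  obtain ⟨hSa, hmax⟩ := mem_longest_iff.1 hS
  have hTc := card_erase_of_mem_available hSa
  have hTH := (mem_available_iff.1 hSa).2.2.trans hw
  obtain ⟨r, hr, hrT⟩ := Finset.exists_mem_notMem_of_card_lt_card
    (show (S.erase v).card < H.card by omega)
  have hcr : ∀ i ∈ H, (H.erase i).card = 2 := fun i hi => by
    rw [Finset.card_erase_of_mem hi, hH]
  have hT : S.erase v = H.erase r := by
    refine Finset.eq_of_subset_of_card_le (Finset.subset_erase.2 ⟨hTH, hrT⟩) ?_
    rw [hcr r hr, hTc]
  refine ⟨r, hr, hT, fun i hi => ?_⟩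
  by_cases hir : i = r
  · rw [hir]
  -- If `r` is present, so is all of `H`, and sparing `i` instead of `r` is also available;
  -- maximality of `S` compares the two counts. If `r` is absent, its count is `0`.
  by_cases hr0 : r ∈ w.toFinset
  · have hvi : v ∉ H.erase i := fun h => hv (Finset.mem_of_mem_erase h)
    have havail : insert v (H.erase i) ∈ available (completeUniform V 3 \ J) w v := by
      refine mem_available_iff.2 ⟨mem_completeUniform_sdiff_of_notMem hdisj hHJ
        (Finset.erase_subset i H) (hcr i hi) hv, Finset.mem_insert_self _ _, ?_⟩
      rw [Finset.erase_insert hvi]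
      intro j hj
      by_cases hjr : j = r
      · rwa [hjr]
      · apply (mem_available_iff.1 hSa).2.2
        rw [hT]
        exact Finset.mem_erase.2 ⟨hjr, Finset.mem_of_mem_erase hj⟩
    have h1 := hmax _ havail
    have hSv := Finset.insert_erase (mem_available_iff.1 hSa).2.1
    rw [← hSv, hT, queueLength, queueLength, Finset.sum_insert hvi,
      Finset.sum_insert fun h => hv (Finset.mem_of_mem_erase h)] at h1
    have h2 := Finset.add_sum_erase H w.count hi
    have h3 := Finset.add_sum_erase H w.count hr
    omega
  · rw [List.mem_toFinset] at hr0
    simp [List.count_eq_zero_of_not_mem hr0]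

end Combinatorics

/-! ### Drift of the energy, by the type of line. -/

section Drift

variable {J : Finset (Finset V)} {ε : ℝ} {w : List V}

theorem energy_concat_le (hε : ε ≤ 1) (v : V) :
    energy ε (w ++ [v]) ≤ energy ε w + (6 * w.count v + (3 - 2 * (1 - ε) * w.length)) := by
  rw [energy_concat]
  linarith

theorem energy_remove_le (hε : ε ≤ 1) {v : V} {S : Finset V}
    (hS : S ∈ available (completeUniform V 3 \ J) w v) {t : ℝ}
    (ht : t ≤ ∑ i ∈ S.erase v, (w.count i : ℝ)) :
    energy ε (remove w v S) ≤ energy ε w + (6 + 4 * (1 - ε) * w.length - 6 * t) := by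
  rw [energy_remove ε (mem_available_iff.1 hS).2.2 (card_erase_of_mem_available hS)]
  linarith

/-- The mean of `B v`, for an arrival of law `μ`, bounds the drift of the energy in the state `w`. -/
def IsDriftBound (J : Finset (Finset V)) (ε : ℝ) (w : List V) (B : V → ℝ) : Prop :=
  ∀ v, ∀ w' ∈ (arrivalML (completeUniform V 3 \ J) w v).support, energy ε w' ≤ energy ε w + B v

theorem isDriftBound_of_card_le_one (hε : ε ≤ 1) (h : w.toFinset.card ≤ 1) :
    IsDriftBound J ε w fun v => 6 * w.count v + (3 - 2 * (1 - ε) * w.length) := by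
  intro v w' hw'
  rcases mem_support_arrivalML.1 hw' with ⟨-, rfl⟩ | ⟨S, hS, rfl⟩
  · exact energy_concat_le hε v
  · have hSa := longest_subset_available _ _ _ hS
    have h1 := Finset.card_le_card (mem_available_iff.1 hSa).2.2
    rw [card_erase_of_mem_available hSa] at h1
    omega

theorem isDriftBound_of_card_eq_two (hε : ε ≤ 1)
    (hc : w.toFinset.card = 2) (h : ∀ H ∈ J, ¬ w.toFinset ⊆ H) :
    IsDriftBound J ε w fun v => if v ∈ w.toFinset
      then 6 * w.count v + (3 - 2 * (1 - ε) * w.length)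
      else 6 + 4 * (1 - ε) * w.length - 6 * w.length := by
  intro v w' hw'
  dsimp only
  split_ifs with hv
  · rcases mem_support_arrivalML.1 hw' with ⟨-, rfl⟩ | ⟨S, hS, rfl⟩
    · exact energy_concat_le hε v
    · have hSa := longest_subset_available _ _ _ hS
      have h1 := Finset.card_le_card (available_subset_insert hSa)
      rw [Finset.insert_eq_of_mem hv,
        (mem_completeUniform_sdiff.1 (mem_available_iff.1 hSa).1).1] at h1
      omega
  · rcases mem_support_arrivalML.1 hw' with ⟨he, rfl⟩ | ⟨S, hS, rfl⟩
    · have : insert v w.toFinset ∈ available (completeUniform V 3 \ J) w v := by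
        refine mem_available_iff.2 ⟨mem_completeUniform_sdiff.2
          ⟨by rw [Finset.card_insert_of_notMem hv, hc],
            fun hmem => h _ hmem (Finset.subset_insert _ _)⟩, Finset.mem_insert_self _ _, ?_⟩
        rw [Finset.erase_insert hv]
      rw [he] at this
      exact absurd this (Finset.notMem_empty _)
    · have hSa := longest_subset_available _ _ _ hS
      refine energy_remove_le hε hSa (le_of_eq ?_)
      rw [Finset.eq_of_subset_of_card_le (mem_available_iff.1 hSa).2.2
        (by rw [card_erase_of_mem_available hSa, hc]), cast_length_eq_sum_of_subset subset_rfl]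

/-- The class spared by ML is a shortest one, so the two removed queues total at least `w.length -
w.count r` whichever `r` in `H` is taken. -/
theorem isDriftBound_of_subset (hdisj : (J : Set (Finset V)).PairwiseDisjoint id)
    (hε : ε ≤ 1) {H : Finset V} (hHJ : H ∈ J) (hH : H.card = 3)
    (hc : 2 ≤ w.toFinset.card) (hw : w.toFinset ⊆ H) {r : V} (hr : r ∈ H) :
    IsDriftBound J ε w fun v => if v ∈ H
      then 6 * w.count v + (3 - 2 * (1 - ε) * w.length)
      else 6 + 4 * (1 - ε) * w.length - 6 * (w.length - w.count r) := by
  intro v w' hw'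
  dsimp only
  split_ifs with hv
  · rcases mem_support_arrivalML.1 hw' with ⟨-, rfl⟩ | ⟨S, hS, rfl⟩
    · exact energy_concat_le hε v
    · have hSa := longest_subset_available _ _ _ hS
      rw [available_eq_empty_of_mem hHJ hH hw hv] at hSa
      exact absurd hSa (Finset.notMem_empty _)
  · rcases mem_support_arrivalML.1 hw' with ⟨he, rfl⟩ | ⟨S, hS, rfl⟩
    · obtain ⟨T, hT, hTc⟩ := Finset.exists_subset_card_eq hc
      have : insert v T ∈ available (completeUniform V 3 \ J) w v := by
        refine mem_available_iff.2 ⟨mem_completeUniform_sdiff_of_notMem hdisj hHJ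
          (hT.trans hw) hTc hv, Finset.mem_insert_self _ _, ?_⟩
        rwa [Finset.erase_insert fun h => hv (hw (hT h))]
      rw [he] at this
      exact absurd this (Finset.notMem_empty _)
    · have hSa := longest_subset_available _ _ _ hS
      refine energy_remove_le hε hSa ?_
      obtain ⟨s, hs, hSs, hmin⟩ := longest_of_subset hdisj hHJ hH hw hv hS
      have h1 := Finset.add_sum_erase H (fun i => (w.count i : ℝ)) hs
      have h2 : (w.count s : ℝ) ≤ w.count r := by exact_mod_cast hmin r hr
      rw [hSs, cast_length_eq_sum_of_subset hw]
      linarith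

theorem exists_isDriftBound (hJ : J ⊆ completeUniform V 3)
    (hdisj : (J : Set (Finset V)).PairwiseDisjoint id) {μ : PMF V} {θ : ℝ} (h0 : 0 < θ)
    (h1 : θ ≤ 1) (hμ : ∀ i, mass μ i ≤ (1 - θ) / 3)
    (hμJ : ∀ H ∈ J, ∑ i ∈ H, mass μ i ≤ (2 - θ) / 3)
    (hw : w ∈ admissible (completeUniform V 3 \ J)) :
    ∃ B, IsDriftBound J (θ / 2) w B ∧ ∑ v, mass μ v * B v ≤ 6 - θ ^ 2 * w.length := by
  have hn : (0 : ℝ) ≤ w.length := Nat.cast_nonneg _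
  have hθn : 0 ≤ θ * w.length := by positivity
  have hθ2 : θ ^ 2 * w.length ≤ θ * w.length := by
    rw [sq, mul_assoc]
    exact mul_le_of_le_one_left hθn h1
  by_cases hH : ∃ H ∈ J, w.toFinset ⊆ H ∧ 2 ≤ w.toFinset.card
  · obtain ⟨H, hHJ, hwH, hc⟩ := hH
    have hH3 : H.card = 3 := (Finset.mem_powersetCard.1 (hJ hHJ)).2
    obtain ⟨r, hr, hmin⟩ := Finset.exists_min_image H w.count (Finset.card_pos.1 (by omega))
    have hmin' : ∀ i ∈ H, (w.count r : ℝ) ≤ w.count i := fun i hi => by exact_mod_cast hmin i hi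
    refine ⟨_, isDriftBound_of_subset hdisj (by linarith) hHJ hH3 hc hwH hr, ?_⟩
    rw [sum_mass_mul_ite]
    simp only [mul_add, Finset.sum_add_distrib, ← Finset.sum_mul, mul_left_comm _ (6 : ℝ),
      ← Finset.mul_sum]
    have h2 := sum_mass_mul_count_le hμ hwH hmin'
    have h3 := hμJ H hHJ
    have h4 : 0 ≤ ∑ i ∈ H, mass μ i := Finset.sum_nonneg fun i _ => mass_nonneg μ i
    have h5 : (H.card : ℝ) * w.count r ≤ w.length := by
      rw [cast_length_eq_sum_of_subset hwH, ← nsmul_eq_mul]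
      exact Finset.card_nsmul_le_sum _ _ _ hmin'
    rw [hH3] at h2 h5
    push_cast at h2 h5
    -- `h6` absorbs the term `6θc` into `2θn`; `h7` then brings in the mass of `H`, leaving `-θ² n`.
    have h6 := mul_nonneg h0.le (sub_nonneg.2 h5)
    have h7 := mul_le_mul_of_nonneg_left h3 hθn
    linarith
  · push Not at hH
    rcases Nat.lt_or_ge w.toFinset.card 2 with hc | hc
    · refine ⟨_, isDriftBound_of_card_le_one (by linarith) (by omega), ?_⟩
      simp only [mul_add, Finset.sum_add_distrib, ← Finset.sum_mul, mul_left_comm _ (6 : ℝ),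
        ← Finset.mul_sum, sum_mass]
      -- Outside the critical case no common level is needed, so `c = 0`.
      have h2 := sum_mass_mul_count_le hμ (Finset.subset_univ w.toFinset) (c := 0)
        fun i _ => Nat.cast_nonneg _
      linarith
    · have hc2 : w.toFinset.card = 2 := by
        by_contra hne
        have h3 := card_toFinset_le_three hdisj hw
        have hc3 : w.toFinset.card = 3 := by omega
        by_cases hm : w.toFinset ∈ J
        · have := hH _ hm subset_rfl
          omega
        · exact mem_admissible_iff.1 hw _ (mem_completeUniform_sdiff.2 ⟨hc3, hm⟩) subset_rfl
      refine ⟨_, isDriftBound_of_card_eq_two (by linarith) hc2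
        fun H hHJ hsub => by have := hH H hHJ hsub; omega, ?_⟩
      rw [sum_mass_mul_ite]
      simp only [mul_add, Finset.sum_add_distrib, ← Finset.sum_mul, mul_left_comm _ (6 : ℝ),
        ← Finset.mul_sum]
      have h2 := sum_mass_mul_count_le hμ (subset_refl w.toFinset) (c := 0)
        fun i _ => Nat.cast_nonneg _
      have h3 : ∑ i ∈ w.toFinset, mass μ i ≤ 2 * ((1 - θ) / 3) := by
        refine (Finset.sum_le_card_nsmul _ _ _ fun i _ => hμ i).trans (le_of_eq ?_)
        rw [hc2, nsmul_eq_mul]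
        push_cast
        ring
      have h4 : 0 ≤ ∑ i ∈ w.toFinset, mass μ i := Finset.sum_nonneg fun i _ => mass_nonneg μ i
      have h7 := mul_le_mul_of_nonneg_left h3 hθn
      have h8 : 0 ≤ θ * (θ * w.length) := by positivity
      linarith

end Drift

end MatchingModel
namespace MatchingModel

variable {V : Type*} [DecidableEq V]

/-! ### Communication of all admissible words. -/

section Reachability

/-- `w'` is a possible successor of the queue detail `w`. -/
def Succ (E : Finset (Finset V)) (μ : PMF V) (w w' : List V) : Prop :=
  transitionML E μ w w' ≠ 0

theorem succ_iff {E : Finset (Finset V)} {μ : PMF V} (hμ : μ ∈ fullSupport V) {w w' : List V} :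
    Succ E μ w w' ↔ ∃ v, w' ∈ (arrivalML E w v).support := by
  have h : ∀ v, v ∈ μ.support := fun v => by
    rw [show μ.support = Set.univ from hμ]
    trivial
  rw [Succ, transitionML, ← PMF.mem_support_iff, PMF.mem_support_bind_iff]
  exact exists_congr fun v => and_iff_right (h v)

theorem admissible_of_concat {E : Finset (Finset V)} {w : List V} {v : V}
    (h : w ++ [v] ∈ admissible E) : w ∈ admissible E := by
  rw [mem_admissible_iff] at h ⊢
  refine fun S hS hsub => h S hS (hsub.trans fun i hi => ?_)
  rw [List.mem_toFinset] at hi ⊢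
  exact List.mem_append_left _ hi

theorem succ_concat {E : Finset (Finset V)} {μ : PMF V} (hμ : μ ∈ fullSupport V)
    {w : List V} {v : V} (h : w ++ [v] ∈ admissible E) : Succ E μ w (w ++ [v]) :=
  (succ_iff hμ).2 ⟨v, mem_support_arrivalML.2
    (Or.inl ⟨(available_eq_empty_iff (admissible_of_concat h)).2 h, rfl⟩)⟩

/-- Prefixes of admissible words are admissible, so the letters of `w` can arrive in order without
any match. -/
theorem reflTransGen_of_mem_admissible {E : Finset (Finset V)} {μ : PMF V}
    (hμ : μ ∈ fullSupport V) {w : List V} (h : w ∈ admissible E) :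
    Relation.ReflTransGen (Succ E μ) [] w := by
  induction w using List.reverseRecOn with
  | nil => exact .refl
  | append_singleton w v ih => exact (ih (admissible_of_concat h)).tail (succ_concat hμ h)

variable [Fintype V] {J : Finset (Finset V)} {μ : PMF V}

theorem mem_admissible_of_card_le_two {w : List V} (h : w.toFinset.card ≤ 2) :
    w ∈ admissible (completeUniform V 3 \ J) := by
  refine mem_admissible_iff.2 fun S hS hsub => ?_
  have h1 := Finset.card_le_card hsub
  rw [(mem_completeUniform_sdiff.1 hS).1] at h1
  omega

theorem exists_succ_length_add_two (hq : 5 ≤ Fintype.card V)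
    (hdisj : (J : Set (Finset V)).PairwiseDisjoint id) (hμ : μ ∈ fullSupport V) {w : List V}
    (hw : w ∈ admissible (completeUniform V 3 \ J)) (hc : 2 ≤ w.toFinset.card) :
    ∃ w' ∈ admissible (completeUniform V 3 \ J),
      Succ (completeUniform V 3 \ J) μ w w' ∧ w'.length + 2 = w.length := by
  obtain ⟨T, hT, hTc⟩ := Finset.exists_subset_card_eq hc
  obtain ⟨v, hv, hvT⟩ := exists_insert_mem hq hdisj hTc
  have ha : insert v T ∈ available (completeUniform V 3 \ J) w v :=
    mem_available_iff.2 ⟨hvT, Finset.mem_insert_self _ _, by rwa [Finset.erase_insert hv]⟩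
  obtain ⟨S, hS⟩ := longest_nonempty ⟨_, ha⟩
  have hSa := longest_subset_available _ _ _ hS
  refine ⟨remove w v S, remove_mem_admissible hw v S,
    (succ_iff hμ).2 ⟨v, mem_support_arrivalML.2 (Or.inr ⟨S, hS, rfl⟩)⟩, ?_⟩
  have h := cast_length_remove (mem_available_iff.1 hSa).2.2
  rw [card_erase_of_mem_available hSa, eq_sub_iff_add_eq] at h
  exact_mod_cast h

theorem reflTransGen_nil (hq : 5 ≤ Fintype.card V)
    (hdisj : (J : Set (Finset V)).PairwiseDisjoint id) (hμ : μ ∈ fullSupport V) {w : List V}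
    (hw : w ∈ admissible (completeUniform V 3 \ J)) :
    Relation.ReflTransGen (Succ (completeUniform V 3 \ J) μ) w [] := by
  induction hn : w.length using Nat.strong_induction_on generalizing w with
  | _ n ih =>
  by_cases h0 : w = []
  · rw [h0]
  by_cases hc : 2 ≤ w.toFinset.card
  · obtain ⟨w', hw', hs, hl⟩ := exists_succ_length_add_two hq hdisj hμ hw hc
    exact .head hs (ih _ (by omega) hw' rfl)
  -- With a single class in line, a second class joins first; the match that follows removes two
  -- items, a net loss of one.
  · obtain ⟨v, hv⟩ : ∃ v, v ∉ w.toFinset := by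
      by_contra! h
      have h1 := Finset.card_le_card (fun v _ => h v : Finset.univ ⊆ w.toFinset)
      rw [Finset.card_univ] at h1
      omega
    have hpos : 0 < w.toFinset.card := Finset.card_pos.2 (List.toFinset_nonempty_iff w |>.2 h0)
    have hcard : (w ++ [v]).toFinset.card = 2 := by
      have h1 : (w ++ [v]).toFinset = insert v w.toFinset := by
        ext
        simp
      rw [h1, Finset.card_insert_of_notMem hv]
      omega
    have hadm : w ++ [v] ∈ admissible (completeUniform V 3 \ J) :=
      mem_admissible_of_card_le_two hcard.le
    obtain ⟨w', hw', hs, hl⟩ := exists_succ_length_add_two hq hdisj hμ hadm hcard.ge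
    rw [List.length_append, List.length_singleton] at hl
    exact .head (succ_concat hμ hadm) (.head hs (ih _ (by omega) hw' rfl))

theorem transGen_of_mem_admissible (hq : 5 ≤ Fintype.card V)
    (hdisj : (J : Set (Finset V)).PairwiseDisjoint id) (hμ : μ ∈ fullSupport V) {w w' : List V}
    (hw : w ∈ admissible (completeUniform V 3 \ J))
    (hw' : w' ∈ admissible (completeUniform V 3 \ J)) :
    Relation.TransGen (Succ (completeUniform V 3 \ J) μ) w w' := by
  obtain ⟨v⟩ : Nonempty V := Fintype.card_pos_iff.1 (by omega)
  have hadm : [] ++ [v] ∈ admissible (completeUniform V 3 \ J) :=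
    mem_admissible_of_card_le_two (by simp)
  -- The detour from `[]` to `[v]` and back makes the path nonempty even when `w` and `w'` are both
  -- empty.
  exact .trans_right (reflTransGen_nil hq hdisj hμ hw)
    (.trans_left (.head' (succ_concat hμ hadm) (reflTransGen_nil hq hdisj hμ hadm))
      (reflTransGen_of_mem_admissible hμ hw'))

end Reachability

/-! ### From the drift bound to stability. -/

section Stability

variable [Fintype V] {J : Finset (Finset V)} {μ : PMF V}

theorem exists_margin {ι : Type*} (s : Finset ι) (g : ι → ℝ) {c : ℝ} (h : ∀ i ∈ s, g i < c) :
    ∃ θ > 0, ∀ i ∈ s, g i ≤ c - θ := by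
  rcases s.eq_empty_or_nonempty with rfl | hs
  · exact ⟨1, one_pos, by simp⟩
  · obtain ⟨j, hj, hmax⟩ := s.exists_max_image g hs
    exact ⟨c - g j, sub_pos.2 (h j hj), fun i hi => by linarith [hmax i hi]⟩

/-- The model on the complete 3-uniform hypergraph with disjoint hyperedges deleted is stable
under Match the Longest if no class has mass `1 / 3` or more and no deleted hyperedge has mass
`2 / 3` or more. -/
theorem isStableML_of_mass_lt (hq : 5 ≤ Fintype.card V) (hJ : J ⊆ completeUniform V 3)
    (hdisj : (J : Set (Finset V)).PairwiseDisjoint id) (hμ : μ ∈ fullSupport V)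
    (h1 : ∀ i, mass μ i < 1 / 3) (h2 : ∀ H ∈ J, ∑ i ∈ H, mass μ i < 2 / 3) :
    IsStableML (completeUniform V 3 \ J) μ := by
  obtain ⟨θ₁, hθ₁, hm₁⟩ := exists_margin Finset.univ (mass μ) fun i _ => h1 i
  obtain ⟨θ₂, hθ₂, hm₂⟩ := exists_margin J (fun H => ∑ i ∈ H, mass μ i) h2
  obtain ⟨θ, hθ, hle₁, hle₂⟩ : ∃ θ > 0, θ ≤ 3 * θ₁ ∧ θ ≤ 3 * θ₂ :=
    ⟨min (3 * θ₁) (3 * θ₂), by positivity, min_le_left _ _, min_le_right _ _⟩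
  obtain ⟨v₀⟩ : Nonempty V := Fintype.card_pos_iff.1 (by omega)
  have hθ1 : θ ≤ 1 := by linarith [hm₁ v₀ (Finset.mem_univ _), mass_nonneg μ v₀]
  have hdrift := fun w (hw : w ∈ admissible (completeUniform V 3 \ J)) =>
    exists_isDriftBound (μ := μ) hJ hdisj hθ hθ1
      (fun i => by linarith [hm₁ i (Finset.mem_univ _)]) (fun H hH => by linarith [hm₂ H hH]) hw
  classical
  intro x hx
  -- The value `∞` off the admissible words makes the drift condition trivial there.
  let f : List V → ℝ≥0∞ := fun w =>
    if w ∈ admissible (completeUniform V 3 \ J) then ENNReal.ofReal (energy (θ / 2) w) else ∞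
  -- The threshold is `7 = 6 + 1`: outside `C` the bound `6 - θ² n` is at most `-1`, and on `C` the
  -- excess is covered by `b = 7`.
  let C : Set (List V) :=
    {w | w ∈ admissible (completeUniform V 3 \ J) ∧ θ ^ 2 * (w.length : ℝ) < 7}
  have hC : C.Finite := by
    refine (List.finite_length_lt V (⌈7 / θ ^ 2⌉₊ + 1)).subset fun w hw => ?_
    have hlt : (w.length : ℝ) < 7 / θ ^ 2 := by
      rw [lt_div_iff₀ (by positivity), mul_comm]
      exact hw.2
    have h3 : (w.length : ℝ) < (⌈7 / θ ^ 2⌉₊ : ℝ) := hlt.trans_le (Nat.le_ceil _)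
    exact Nat.lt_succ_of_lt (by exact_mod_cast h3)
  refine MarkovChain.isPosRecState_of_drift (f := f) (b := 7) hC (by simp) (fun w => ?_)
    (by simp [f, hx]) fun w hw => transGen_of_mem_admissible hq hdisj hμ hw.1 hx
  by_cases hw : w ∈ admissible (completeUniform V 3 \ J)
  · obtain ⟨B, hB, hsum⟩ := hdrift w hw
    have hnn : ∀ z ∈ admissible (completeUniform V 3 \ J), 0 ≤ energy (θ / 2) z := fun z hz =>
      energy_nonneg (by positivity) (card_toFinset_le_three hdisj hz)
    -- `ENNReal.ofReal` is additive only on nonnegative terms; each bound dominates the energy of an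
    -- actual successor.
    have hBnn : ∀ v, 0 ≤ energy (θ / 2) w + B v := fun v => by
      obtain ⟨z, hz⟩ := (arrivalML (completeUniform V 3 \ J) w v).support_nonempty
      exact (hnn z (mem_admissible_of_mem_support hw hz)).trans (hB v z hz)
    have hle := tsum_transitionML_mul_le (E := completeUniform V 3 \ J) (μ := μ) (w := w) (F := f)
      (B := fun v => ENNReal.ofReal (energy (θ / 2) w + B v)) fun v w' hw' => by
        simp only [f, if_pos (mem_admissible_of_mem_support hw hw')]
        exact ENNReal.ofReal_le_ofReal (hB v w' hw')
    have hmean : ∑ v, μ v * ENNReal.ofReal (energy (θ / 2) w + B v)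
        = ENNReal.ofReal (energy (θ / 2) w + ∑ v, mass μ v * B v) := by
      simp only [← ofReal_mass μ, ← ENNReal.ofReal_mul (mass_nonneg μ _)]
      rw [← ENNReal.ofReal_sum_of_nonneg fun v _ => mul_nonneg (mass_nonneg μ v) (hBnn v)]
      simp only [mul_add, Finset.sum_add_distrib, ← Finset.sum_mul, sum_mass, one_mul]
    have hmnn : 0 ≤ energy (θ / 2) w + ∑ v, mass μ v * B v := by
      have h3 := Finset.sum_nonneg fun v (_ : v ∈ Finset.univ) =>
        mul_nonneg (mass_nonneg μ v) (hBnn v)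
      simpa only [mul_add, Finset.sum_add_distrib, ← Finset.sum_mul, sum_mass, one_mul] using h3
    rw [hmean] at hle
    refine (add_le_add_left hle 1).trans ?_
    simp only [f, if_pos hw]
    rw [← ENNReal.ofReal_one, ← ENNReal.ofReal_add hmnn zero_le_one]
    by_cases hwC : w ∈ C
    · rw [Set.indicator_of_mem hwC, Pi.one_apply, mul_one, ← ENNReal.ofReal_ofNat 7,
        ← ENNReal.ofReal_add (hnn w hw) (by norm_num)]
      refine ENNReal.ofReal_le_ofReal ?_
      have : 0 ≤ θ ^ 2 * (w.length : ℝ) := by positivity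
      linarith
    · rw [Set.indicator_of_notMem hwC, mul_zero, add_zero]
      refine ENNReal.ofReal_le_ofReal ?_
      have : 7 ≤ θ ^ 2 * (w.length : ℝ) := not_lt.1 fun h => hwC ⟨hw, h⟩
      linarith
  · simp [f, hw]

theorem completeUniform_sdiff_nonempty (hq : 5 ≤ Fintype.card V)
    (hdisj : (J : Set (Finset V)).PairwiseDisjoint id) :
    (completeUniform V 3 \ J).Nonempty := by
  obtain ⟨T, -, hT⟩ := Finset.exists_subset_card_eq
    (show 2 ≤ (Finset.univ : Finset V).card by rw [Finset.card_univ]; omega)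
  obtain ⟨v, -, hv⟩ := exists_insert_mem hq hdisj hT
  exact ⟨_, hv⟩

theorem rank_completeUniform_sdiff (h : (completeUniform V 3 \ J).Nonempty) :
    rank (completeUniform V 3 \ J) = 3 := by
  rw [rank, Finset.sup_congr rfl fun S hS => (mem_completeUniform_sdiff.1 hS).1,
    Finset.sup_const h]

theorem antiRank_completeUniform_sdiff (h : (completeUniform V 3 \ J).Nonempty) :
    antiRank (completeUniform V 3 \ J) = 3 := by
  obtain ⟨S, hS⟩ := h
  have : {n | ∃ S ∈ completeUniform V 3 \ J, S.card = n} = {3} := by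
    refine Set.eq_singleton_iff_unique_mem.2 ⟨⟨S, hS, (mem_completeUniform_sdiff.1 hS).1⟩, ?_⟩
    rintro n ⟨S', hS', rfl⟩
    exact (mem_completeUniform_sdiff.1 hS').1
  rw [antiRank, this, csInf_singleton]

/-- The only triple inside `H` is `H` itself, which is deleted. Under `N2` this bounds the mass of
`H` by `2 / 3`. -/
theorem isTransversal_compl {H : Finset V} (hHJ : H ∈ J) (hH : H.card = 3) :
    IsTransversal (completeUniform V 3 \ J) Hᶜ := by
  intro S hS
  obtain ⟨hc, hSJ⟩ := mem_completeUniform_sdiff.1 hS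
  by_contra! h
  have hsub : S ⊆ H := fun i hi => by
    by_contra hiH
    exact h i (Finset.mem_compl.2 hiH) hi
  exact hSJ (Finset.eq_of_subset_of_card_le hsub (by omega) ▸ hHJ)

end Stability

end MatchingModel

theorem mainTheorem6 {V : Type*} [Fintype V] [DecidableEq V]
    (hq : 5 ≤ Fintype.card V)
    (J : Finset (Finset V)) (hJ : J ⊆ MatchingModel.completeUniform V 3)
    (hdisj : (J : Set (Finset V)).PairwiseDisjoint id)
    (μ : PMF V) (hμ : μ ∈ MatchingModel.fullSupport V)
    (hlam : ∀ i : V, (∀ H ∈ J, i ∉ H) →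
      MatchingModel.driftLambda (MatchingModel.mass μ) i < 0)
    (hnu : ∀ H ∈ J, ∀ i ∈ H,
      MatchingModel.driftNu (MatchingModel.mass μ) H i < 0)
    (hN2 : μ ∈ MatchingModel.N2 (MatchingModel.completeUniform V 3 \ J))
    (hN3 : μ ∈ MatchingModel.N3minus (MatchingModel.completeUniform V 3 \ J)) :
    MatchingModel.IsStableML (MatchingModel.completeUniform V 3 \ J) μ := by
  have hne := MatchingModel.completeUniform_sdiff_nonempty hq hdisj
  refine MatchingModel.isStableML_of_mass_lt hq hJ hdisj hμ (fun i => ?_) fun H hH => ?_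
  · have h := hN3.2 i
    rw [MatchingModel.antiRank_completeUniform_sdiff hne] at h
    exact_mod_cast h
  · have h := hN2.2 _ (MatchingModel.isTransversal_compl hH (Finset.mem_powersetCard.1 (hJ hH)).2)
    rw [MatchingModel.rank_completeUniform_sdiff hne] at h
    have hs := Finset.sum_add_sum_compl H (MatchingModel.mass μ)
    rw [MatchingModel.sum_mass] at hs
    push_cast at h
    linarith
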